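/- Conventions. Let $\mathbb{C}$ be a pointed category with finite limits. A monomorphism $m:S\to Y$ is a \emph{Bourn-normal monomorphism} if there are an internal equivalence relation $r_1,r_2:R\to Y$ and a morphism $\tilde m:S\times S\to R$ such that $r_i\tilde m=m\pi_i$ ($i=1,2$) and both of these commutative squares are pullbacks. A morphism $u:S\to X$ is a \emph{characteristic monomorphism} if for each Bourn-normal monomorphism $n:X\to Y$ the composite $nu$ is a Bourn-normal monomorphism. A \emph{split extension} with kernel $X$ is a diagram $X\xrightarrow{\kappa}A\underset{\beta}{\overset{\alpha}{\rightleftarrows}}B$ in which $\kappa$ is a kernel of $\alpha$ and $\alpha\beta=1_B$. A morphism from it to $X'\xrightarrow{\kappa'}A'\underset{\beta'}{\overset{\alpha'}{\rightleftarrows}}B'$ is a triple $(u,v,w)$ of morphisms $u:X\to X'$, $v:A\to A'$, $w:B\to B'$ with $v\kappa=\kappa'u$, $v\beta=\beta'w$ and $\alpha'v=w\alpha$. A \emph{generic split extension with kernel $X$}, written $X\xrightarrow{k}[X]\ltimes X\underset{i}{\overset{p_1}{\rightleftarrows}}[X]$, is a terminal object in the category of split extensions with kernel $X$ and morphisms of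 the form $(1_X,v,w)$. The category $\mathbb{C}$ is \emph{protomodular} if for each morphism $(u,v,w)$ of split extensions in which $u$ and $w$ are isomorphisms, $v$ is an isomorphism. It is \emph{strongly protomodular} if moreover for each morphism $(f,g,1_B)$ from a split extension $(\kappa,\alpha,\beta)$ to a split extension $(\sigma,\gamma,\delta)$ with the same base $B$, the morphism $f$ is a Bourn-normal monomorphism if and only if $\sigma f$ is. Let $\mathbb{C}^{\mathbf 2}$ be the category of morphisms of $\mathbb{C}$, with objects written $(S,X,u)$ for $u:S\to X$ in $\mathbb{C}$. The codomain part of a generic split extension with kernel $(S,X,u)$ in $\mathbb{C}^{\mathbf 2}$ is a generic split extension with kernel $X$ in $\mathbb{C}$, so, after identifying it with the chosen one by the unique isomorphism over $X$, the base of this generic split extension is a morphism of $\mathbb{C}$ written $q_2:[S,X,u]\to[X]$. Theorem. Let $\mathbb{C}$ be a pointed protomodular category with finite limits, let $X$ be an object of $\mathbb{C}$ such that the generic split extension with kernel $X$ exists, and let $u:S\to X$ be a morphism. (i) The morphism $u$ is a characteristic monomorphism if and only if the composite $ku:S\to[X]\ltimes X$ is a Bourn-normal monomorphism. (ii) If $u$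 is a characteristic monomorphism, then the generic split extension with kernel $(S,X,u)$ exists in $\mathbb{C}^{\mathbf 2}$ and $q_2:[S,X,u]\to[X]$ is an isomorphism. Furthermore, when $\mathbb{C}$ is strongly protomodular the converse of (ii) holds for monomorphisms: if $u$ is a monomorphism, the generic split extension with kernel $(S,X,u)$ exists in $\mathbb{C}^{\mathbf 2}$, and $q_2$ is an isomorphism, then $u$ is a characteristic monomorphism. -/

import Mathlib

open CategoryTheory CategoryTheory.Limits

universe v u

namespace SplitExtensions

section BournNormal

variable {C : Type u} [Category.{v} C] [HasFiniteLimits C]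

/-- `m : S ⟶ X` is Bourn-normal to the pair `r₁, r₂ : R ⟶ X`: there is `t : S × S ⟶ R` such that
both squares `t ≫ r₁ = π₁ ≫ m` and `t ≫ r₂ = π₂ ≫ m` are pullbacks. -/
def IsBournNormalTo {S X R : C} (m : S ⟶ X) (r₁ r₂ : R ⟶ X) : Prop :=
  ∃ t : S ⨯ S ⟶ R, IsPullback t prod.fst r₁ m ∧ IsPullback t prod.snd r₂ m

/-- A Bourn-normal monomorphism: a monomorphism which is Bourn-normal to some internal
equivalence relation on its codomain. -/
def IsBournNormal {S X : C} (m : S ⟶ X) : Prop :=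
  Mono m ∧ ∃ (R : C) (r₁ r₂ : R ⟶ X), IsEquivalenceRelation r₁ r₂ ∧ IsBournNormalTo m r₁ r₂

/-- A characteristic monomorphism: composing it with any Bourn-normal monomorphism gives a
Bourn-normal monomorphism. -/
def IsCharacteristic {S X : C} (u : S ⟶ X) : Prop :=
  ∀ ⦃Y : C⦄ (n : X ⟶ Y), IsBournNormal n → IsBournNormal (u ≫ n)

end BournNormal

section Basic

variable {C : Type u} [Category.{v} C] [HasZeroMorphisms C]

/-- The diagram `X ⟶ A ⇄ B`, given by `κ : X ⟶ A`, `α : A ⟶ B` and `β : B ⟶ A`, is a split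
extension: `β` is a section of `α`, and `κ` is the kernel of `α`. -/
structure IsSplitExt {X A B : C} (κ : X ⟶ A) (α : A ⟶ B) (β : B ⟶ A) : Prop where
  section_comp : β ≫ α = 𝟙 B
  zero : κ ≫ α = 0
  isKernel : Nonempty (IsLimit (KernelFork.ofι κ zero))

/-- A split extension in `C` with kernel object `X`. -/
structure SplitExt (X : C) where
  A : C
  B : C
  κ : X ⟶ A
  α : A ⟶ B
  β : B ⟶ A
  isSplitExt : IsSplitExt κ α β

namespace SplitExt

/-- A morphism of split extensions `(u, v, w)` with prescribed component `u` on the kernels. -/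
@[ext]
structure HomOver {X X' : C} (u : X ⟶ X') (E : SplitExt X) (E' : SplitExt X') where
  v : E.A ⟶ E'.A
  w : E.B ⟶ E'.B
  κ_comm : E.κ ≫ v = u ≫ E'.κ
  β_comm : E.β ≫ v = w ≫ E'.β
  α_comm : v ≫ E'.α = E.α ≫ w

/-- The fiber over `X` of the functor sending a split extension to its kernel object: its objects
are the split extensions with kernel `X`, its morphisms are the morphisms of split extensions
whose component on the kernels is `𝟙 X`. -/
instance (X : C) : Category (SplitExt X) where
  Hom E E' := HomOver (𝟙 X) E E'
  id E := ⟨𝟙 E.A, 𝟙 E.B, by simp, by simp, by simp⟩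
  comp {E F G} f g :=
    { v := f.v ≫ g.v
      w := f.w ≫ g.w
      κ_comm := by rw [← Category.assoc, f.κ_comm, Category.id_comp, g.κ_comm]
      β_comm := by rw [← Category.assoc, f.β_comm, Category.assoc, g.β_comm, Category.assoc]
      α_comm := by rw [Category.assoc, g.α_comm, ← Category.assoc, f.α_comm, Category.assoc] }
  id_comp f := HomOver.ext (Category.id_comp f.v) (Category.id_comp f.w)
  comp_id f := HomOver.ext (Category.comp_id f.v) (Category.comp_id f.w)
  assoc f g h := HomOver.ext (Category.assoc f.v g.v h.v) (Category.assoc f.w g.w h.w)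

end SplitExt

/-- A generic split extension with kernel `X`: a terminal object of the fiber over `X`. -/
abbrev IsGeneric {X : C} (G : SplitExt X) : Type _ := IsTerminal G

variable (C) in
/-- (Bourn-)protomodularity of a pointed category with finite limits, as the split short five
lemma. -/
def IsProtomodular : Prop :=
  ∀ ⦃X X' : C⦄ (u : X ⟶ X') (E : SplitExt X) (E' : SplitExt X') (f : SplitExt.HomOver u E E'),
    IsIso u → IsIso f.w → IsIso f.v

variable (C) in
/-- Strong protomodularity of a pointed category with finite limits: it is protomodular, and for
each morphism of split extensions `(f, g, 𝟙 B)` from `(κ, α, β)` to `(σ, γ, δ)`, the morphism `f`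
is Bourn-normal if and only if `f ≫ σ` is. -/
def IsStronglyProtomodular [HasFiniteLimits C] : Prop :=
  IsProtomodular C ∧
    ∀ ⦃X Z A D B : C⦄ (κ : X ⟶ A) (α : A ⟶ B) (β : B ⟶ A) (σ : Z ⟶ D) (γ : D ⟶ B) (δ : B ⟶ D)
      (f : X ⟶ Z) (g : A ⟶ D), IsSplitExt κ α β → IsSplitExt σ γ δ →
      κ ≫ g = f ≫ σ → β ≫ g = δ → g ≫ γ = α → (IsBournNormal f ↔ IsBournNormal (f ≫ σ))

end Basic

section ArrowCategory

variable {C : Type u} [Category.{v} C] [HasZeroMorphisms C]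

/-- The category of morphisms of `C` has zero morphisms, given componentwise. -/
instance : HasZeroMorphisms (Arrow C) where
  zero X Y := ⟨Arrow.homMk (0 : X.left ⟶ Y.left) (0 : X.right ⟶ Y.right) (by simp)⟩
  comp_zero f Z := by
    apply Arrow.hom_ext
    · exact comp_zero (f := f.left)
    · exact comp_zero (f := f.right)
  zero_comp X _ _ f := by
    apply Arrow.hom_ext
    · exact zero_comp (f := f.left)
    · exact zero_comp (f := f.right)

@[simp] lemma arrow_zero_left (X Y : Arrow C) : Arrow.Hom.left (0 : X ⟶ Y) = 0 := rfl

@[simp] lemma arrow_zero_right (X Y : Arrow C) : Arrow.Hom.right (0 : X ⟶ Y) = 0 := rfl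

variable [HasZeroObject C]

open scoped ZeroObject in
/-- The codomain of a split extension in the category of morphisms is a split extension in `C`. -/
lemma IsSplitExt.right {X A B : Arrow C} {κ : X ⟶ A} {α : A ⟶ B} {β : B ⟶ A}
    (h : IsSplitExt κ α β) :
    IsSplitExt (Arrow.Hom.right κ) (Arrow.Hom.right α) (Arrow.Hom.right β) where
  section_comp := congrArg Arrow.Hom.right h.section_comp
  zero := congrArg Arrow.Hom.right h.zero
  isKernel := by
    obtain ⟨hl⟩ := h.isKernel
    have key : ∀ {W : C} (t : W ⟶ A.right) (_ : t ≫ Arrow.Hom.right α = 0),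
        ∃ s : W ⟶ X.right, s ≫ Arrow.Hom.right κ = t := by
      intro W t ht
      let T : Arrow.mk (0 : (0 : C) ⟶ W) ⟶ A := Arrow.homMk (0 : (0 : C) ⟶ A.left) t (by simp)
      have hT : T ≫ α = 0 := by
        apply Arrow.hom_ext
        · exact zero_comp
        · exact ht
      obtain ⟨s, hs⟩ := KernelFork.IsLimit.lift' hl T hT
      exact ⟨Arrow.Hom.right s, congrArg Arrow.Hom.right hs⟩
    have mono : ∀ {W : C} (s s' : W ⟶ X.right),
        s ≫ Arrow.Hom.right κ = s' ≫ Arrow.Hom.right κ → s = s' := by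
      intro W s s' hs
      let T : Arrow.mk (0 : (0 : C) ⟶ W) ⟶ X := Arrow.homMk (0 : (0 : C) ⟶ X.left) s (by simp)
      let T' : Arrow.mk (0 : (0 : C) ⟶ W) ⟶ X := Arrow.homMk (0 : (0 : C) ⟶ X.left) s' (by simp)
      have hT : T = T' := Fork.IsLimit.hom_ext hl (by
        apply Arrow.hom_ext
        · rfl
        · exact hs)
      exact congrArg Arrow.Hom.right hT
    choose l hl' using @key
    exact ⟨KernelFork.IsLimit.ofι _ _ (fun t ht => l t ht) (fun t ht => hl' t ht)
      (fun t ht m hm => mono _ _ (hm.trans (hl' t ht).symm))⟩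

/-- The split extension with kernel `X` which is the codomain of a split extension with kernel
`(S, X, u)` in the category of morphisms. -/
def SplitExt.cod {S X : C} {u : S ⟶ X} (E : SplitExt (Arrow.mk u)) : SplitExt X where
  A := E.A.right
  B := E.B.right
  κ := Arrow.Hom.right E.κ
  α := Arrow.Hom.right E.α
  β := Arrow.Hom.right E.β
  isSplitExt := E.isSplitExt.right

open scoped ZeroObject in
/-- The split extension `S ⟶ S ⇄ 0` as the domain, and `F` as the codomain, of a split extension
with kernel `(S, X, u)` in the category of morphisms. -/
noncomputable def SplitExt.ofCod {S X : C} (u : S ⟶ X) (F : SplitExt X) : SplitExt (Arrow.mk u) where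
  A := Arrow.mk (u ≫ F.κ)
  B := Arrow.mk (0 : (0 : C) ⟶ F.B)
  κ := Arrow.homMk (𝟙 S) F.κ (by simp)
  α := Arrow.homMk (0 : S ⟶ (0 : C)) F.α (by simp [F.isSplitExt.zero])
  β := Arrow.homMk (0 : (0 : C) ⟶ S) F.β (by simp)
  isSplitExt :=
    { section_comp := by
        apply Arrow.hom_ext
        · exact (isZero_zero C).eq_of_src _ _
        · exact F.isSplitExt.section_comp
      zero := by
        apply Arrow.hom_ext
        · exact comp_zero
        · exact F.isSplitExt.zero
      isKernel := by
        obtain ⟨hl⟩ := F.isSplitExt.isKernel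
        have hm : Mono F.κ := ⟨fun a b h => Fork.IsLimit.hom_ext hl h⟩
        have key : ∀ {W : Arrow C} (t : W ⟶ Arrow.mk (u ≫ F.κ))
            (_ : t.right ≫ F.α = 0), ∃ s : W ⟶ Arrow.mk u, s.left = t.left ∧
              s.right ≫ F.κ = t.right := by
          intro W t ht
          obtain ⟨s, hs⟩ := KernelFork.IsLimit.lift' hl t.right ht
          have hs : s ≫ F.κ = t.right := hs
          refine ⟨Arrow.homMk t.left s ?_, rfl, hs⟩
          have := t.w
          dsimp at this ⊢
          rw [← cancel_mono F.κ, Category.assoc, Category.assoc, hs, this]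
        choose l hl1 hl2 using @key
        refine ⟨KernelFork.IsLimit.ofι _ _
          (fun t ht => l t (congrArg Arrow.Hom.right ht)) ?_ ?_⟩
        · intro W t ht
          apply Arrow.hom_ext
          · exact (Category.comp_id _).trans (hl1 t _)
          · exact hl2 t _
        · intro W t ht m hm'
          apply Arrow.hom_ext
          · refine Eq.trans ?_ (hl1 t _).symm
            exact (Category.comp_id _).symm.trans (congrArg Arrow.Hom.left hm')
          · refine (cancel_mono F.κ).1 ?_
            exact (congrArg Arrow.Hom.right hm').trans (hl2 t _).symm }

open scoped ZeroObject in
/-- The codomain of a generic split extension in the category of morphisms is a generic split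
extension in `C`. -/
lemma SplitExt.nonempty_isGeneric_cod {S X : C} {u : S ⟶ X} {E : SplitExt (Arrow.mk u)}
    (hE : IsGeneric E) : Nonempty (IsGeneric E.cod) := by
  have toArrow : ∀ {F : SplitExt X} (f : F ⟶ E.cod),
      ∃ g : SplitExt.ofCod u F ⟶ E, Arrow.Hom.right g.v = f.v ∧ Arrow.Hom.right g.w = f.w := by
    intro F f
    have hκ : F.κ ≫ f.v = Arrow.Hom.right E.κ := f.κ_comm.trans (Category.id_comp _)
    have hE1 : Arrow.Hom.left E.κ ≫ E.A.hom = u ≫ Arrow.Hom.right E.κ := E.κ.w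
    refine ⟨⟨Arrow.homMk (u := (Arrow.Hom.left E.κ : S ⟶ E.A.left)) (v := f.v) ?_,
      Arrow.homMk (u := (0 : (0 : C) ⟶ E.B.left)) (v := f.w) ?_, ?_, ?_, ?_⟩, rfl, rfl⟩
    · exact hE1.trans ((congrArg (u ≫ ·) hκ.symm).trans (Category.assoc _ _ _).symm)
    · exact (isZero_zero C).eq_of_src _ _
    · apply Arrow.hom_ext
      · rfl
      · exact f.κ_comm
    · apply Arrow.hom_ext
      · exact (isZero_zero C).eq_of_src _ _
      · exact f.β_comm
    · apply Arrow.hom_ext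
      · exact (congrArg Arrow.Hom.left E.isSplitExt.zero).trans zero_comp.symm
      · exact f.α_comm
  refine ⟨IsTerminal.ofUniqueHom (fun F => ?_) (fun F m => ?_)⟩
  · let g := hE.from (SplitExt.ofCod u F)
    exact ⟨Arrow.Hom.right g.v, Arrow.Hom.right g.w, congrArg Arrow.Hom.right g.κ_comm,
      congrArg Arrow.Hom.right g.β_comm, congrArg Arrow.Hom.right g.α_comm⟩
  · obtain ⟨g, h1, h2⟩ := toArrow m
    obtain rfl := hE.hom_ext g (hE.from (SplitExt.ofCod u F))
    exact HomOver.ext h1.symm h2.symm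

/-- The morphism `q₂ : [S, X, u] ⟶ [X]` from a split extension `E` with kernel `(S, X, u)` in the
category of morphisms, where `[S, X, u]` is the domain of the base of `E` and `[X]` is the base of
the generic split extension `G` with kernel `X`. It is the base of `E` (a morphism of `C`), followed
by the canonical morphism identifying the codomain of `E` with `G`, an isomorphism when `E` is
generic. -/
def q₂ {S X : C} {u : S ⟶ X} {G : SplitExt X} (hG : IsGeneric G) (E : SplitExt (Arrow.mk u)) :
    E.B.left ⟶ G.B :=
  E.B.hom ≫ (hG.from E.cod).w

end ArrowCategory

end SplitExtensions

/-!
In a pointed protomodular category, the kernel and the section of a split extension are jointly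
strongly epic (`IsProtomodular.exists_factor`). Hence every reflexive relation is Euclidean, and so
an equivalence relation, and a monomorphism is Bourn-normal exactly when it is the zero class of a
reflexive relation (`IsBournNormal.exists_zeroClass`, `IsProtomodular.isBournNormal_of_zeroClass`).
Such a relation `p, q : T ⟶ Y` with reflexivity `δ` and zero class `ζ ≫ q` is here a split extension
`(ζ, p, δ)` together with `q`, so that no symmetry or transitivity ever has to be checked.

Let `X ⟶ [X] ⋉ X ⇄ [X]`, with maps `k`, `p₁`, `i`, be generic.

* Suppose that `k u` is the zero class of `Q`, and `n : X ⟶ Y` that of `R`. The split extension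
  `X ⟶ R ⇄ Y` has a morphism `v : R ⟶ [X] ⋉ X` to the generic one, and the pairs `(y, y')` in `R`
  with `v (y, y)` and `v (y, y')` related by `Q` form a reflexive relation on `Y` whose zero class
  is `n u`. As `k` is itself Bourn-normal, this proves (i).
* With the same `Q`, the elements `a` of `[X] ⋉ X` related to `i (p₁ a)` form a subobject containing
  `i` and meeting `X` in `S`. It is a split extension with kernel `S` and base `[X]`, and its
  inclusion in `[X] ⋉ X` is a generic split extension with kernel `(S, X, u)`, by joint strong
  epimorphy. Its base is the identity of `[X]`, whence (ii).
* Conversely, if `q₂` is an isomorphism, the domain of the generic split extension of `(S, X, u)`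
  is a subobject `D` of `[X] ⋉ X`, a split extension over `[X]` with kernel `S`. Its inverse image
  along the morphism `X ⨯ X ⟶ [X] ⋉ X` that classifies the conjugation of `X` on itself is a reflexive
  relation on `X` with zero class `u`, so `u` is Bourn-normal. Strong protomodularity, applied to
  the inclusion of `D`, turns this into the Bourn-normality of `k u`.
-/

namespace SplitExtensions

attribute [local simp] pullback.lift_fst pullback.lift_fst_assoc pullback.lift_snd
  pullback.lift_snd_assoc prod.lift_fst prod.lift_fst_assoc prod.lift_snd prod.lift_snd_assoc

/-! ### Split extensions in protomodular categories -/

section Basic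

variable {C : Type u} [Category.{v} C] [HasZeroMorphisms C]

lemma IsSplitExt.mono {X A B : C} {κ : X ⟶ A} {α : A ⟶ B} {β : B ⟶ A} (h : IsSplitExt κ α β) :
    Mono κ := by
  obtain ⟨hl⟩ := h.isKernel
  exact ⟨fun a b hab => Fork.IsLimit.hom_ext hl hab⟩

lemma IsSplitExt.exists_lift {X A B : C} {κ : X ⟶ A} {α : A ⟶ B} {β : B ⟶ A}
    (h : IsSplitExt κ α β) {W : C} (t : W ⟶ A) (ht : t ≫ α = 0) : ∃ s : W ⟶ X, s ≫ κ = t := by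
  obtain ⟨hl⟩ := h.isKernel
  obtain ⟨s, hs⟩ := KernelFork.IsLimit.lift' hl t ht
  exact ⟨s, hs⟩

/-- The kernel condition in a split extension, tested on generalized elements. -/
lemma IsSplitExt.of_exists_lift {X A B : C} {κ : X ⟶ A} {α : A ⟶ B} {β : B ⟶ A}
    (hβ : β ≫ α = 𝟙 B) (hκ : κ ≫ α = 0) [Mono κ]
    (hl : ∀ ⦃W : C⦄ (t : W ⟶ A), t ≫ α = 0 → ∃ s : W ⟶ X, s ≫ κ = t) : IsSplitExt κ α β where
  section_comp := hβ
  zero := hκ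
  isKernel := by
    choose l hl' using hl
    exact ⟨KernelFork.IsLimit.ofι _ _ (fun t ht => l t ht) (fun t ht => hl' t ht)
      (fun t ht m hm => (cancel_mono κ).1 (hm.trans (hl' t ht).symm))⟩

/-- In a split extension of a protomodular category, the kernel and the section are jointly
strongly epic: a morphism whose restrictions to both of them factor through a monomorphism `m`
factors through `m`. -/
lemma IsProtomodular.exists_factor [HasFiniteLimits C] (hC : IsProtomodular C)
    {X A B N Z : C} {κ : X ⟶ A} {α : A ⟶ B} {β : B ⟶ A} (h : IsSplitExt κ α β)
    (f : A ⟶ Z) (m : N ⟶ Z) [Mono m] (a : X ⟶ N) (b : B ⟶ N)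
    (ha : a ≫ m = κ ≫ f) (hb : b ≫ m = β ≫ f) : ∃ g : A ⟶ N, g ≫ m = f := by
  have := h.mono
  have hmono : Mono (pullback.lift a κ ha) :=
    mono_of_mono_fac (pullback.lift_snd a κ ha)
  -- the inverse image of `m` along `f` is a split extension with the same kernel and base
  have h' : IsSplitExt (pullback.lift a κ ha) (pullback.snd m f ≫ α) (pullback.lift b β hb) := by
    refine .of_exists_lift ?_ ?_ ?_
    · rw [pullback.lift_snd_assoc, h.section_comp]
    · rw [pullback.lift_snd_assoc, h.zero]
    · intro W t ht
      obtain ⟨s, hs⟩ := h.exists_lift (t ≫ pullback.snd m f) (by simpa using ht)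
      exact ⟨s, (cancel_mono (pullback.snd m f)).1 (by simpa using hs)⟩
  have hiso : IsIso (pullback.snd m f) :=
    hC (𝟙 X) ⟨_, _, _, _, _, h'⟩ ⟨_, _, _, _, _, h⟩
      ⟨pullback.snd m f, 𝟙 B, by simp, by simp, by simp⟩ inferInstance inferInstance
  refine ⟨inv (pullback.snd m f) ≫ pullback.fst m f, ?_⟩
  rw [Category.assoc, pullback.condition, IsIso.inv_hom_id_assoc]

/-- In a protomodular category, a morphism between split extensions over the same base is a
monomorphism as soon as its restriction to the kernels is. -/
lemma IsProtomodular.mono_of_mono_kernel [HasFiniteLimits C] (hC : IsProtomodular C)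
    {X X' A A' B : C} {κ : X ⟶ A} {α : A ⟶ B} {β : B ⟶ A} (h : IsSplitExt κ α β)
    (κ' : X' ⟶ A') (α' : A' ⟶ B) [Mono κ'] (u : X ⟶ X') [Mono u] (g : A ⟶ A')
    (hκ : κ ≫ g = u ≫ κ') (hα : g ≫ α' = α) : Mono g := by
  have := h.mono
  have hmono : Mono (pullback.lift κ κ rfl : X ⟶ pullback g g) :=
    mono_of_mono_fac (pullback.lift_fst κ κ rfl)
  have hdiag : Mono (pullback.lift (𝟙 A) (𝟙 A) rfl : A ⟶ pullback g g) :=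
    mono_of_mono_fac (pullback.lift_fst (𝟙 A) (𝟙 A) rfl)
  -- the kernel pair of `g` is a split extension with kernel `X`, like `A` itself
  have h' : IsSplitExt (pullback.lift κ κ rfl : X ⟶ pullback g g) (pullback.fst g g ≫ α)
      (pullback.lift β β rfl) := by
    refine .of_exists_lift ?_ ?_ ?_
    · rw [pullback.lift_fst_assoc, h.section_comp]
    · rw [pullback.lift_fst_assoc, h.zero]
    · intro W t ht
      obtain ⟨s, hs⟩ := h.exists_lift (t ≫ pullback.fst g g) (by simpa using ht)
      obtain ⟨s', hs'⟩ := h.exists_lift (t ≫ pullback.snd g g) (by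
        rw [← hα, Category.assoc, ← pullback.condition_assoc, hα, ht])
      have hss : s = s' := by
        rw [← cancel_mono (u ≫ κ'), ← hκ, reassoc_of% hs, reassoc_of% hs', pullback.condition]
      subst hss
      exact ⟨s, by exact pullback.hom_ext (by simp [hs]) (by simp [hs'])⟩
  obtain ⟨d, hd⟩ := hC.exists_factor h' (𝟙 _) (pullback.lift (𝟙 A) (𝟙 A) rfl) κ β
    (by apply pullback.hom_ext <;> simp) (by apply pullback.hom_ext <;> simp)
  have hfs : pullback.fst g g = pullback.snd g g := by
    rw [← Category.id_comp (pullback.fst g g), ← Category.id_comp (pullback.snd g g), ← hd]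
    simp
  refine ⟨fun x y hxy => ?_⟩
  rw [← pullback.lift_fst x y hxy, hfs, pullback.lift_snd]

end Basic

/-! ### Reflexive relations and Bourn-normal monomorphisms -/

section BournNormal

lemma isPullback_of_exists_lift {C : Type u} [Category.{v} C] {P A B D : C}
    {a : P ⟶ A} {b : P ⟶ B} {f : A ⟶ D} {g : B ⟶ D}
    (w : a ≫ f = b ≫ g) [Mono a]
    (hl : ∀ ⦃W : C⦄ (x : W ⟶ A) (y : W ⟶ B), x ≫ f = y ≫ g → ∃ l : W ⟶ P, l ≫ a = x ∧ l ≫ b = y) :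
    IsPullback a b f g := by
  choose l hl₁ hl₂ using hl
  exact ⟨⟨w⟩, ⟨PullbackCone.IsLimit.mk w (fun s => l s.fst s.snd s.condition)
    (fun s => hl₁ _ _ _) (fun s => hl₂ _ _ _)
    (fun s m hm _ => (cancel_mono a).1 (hm.trans (hl₁ _ _ _).symm))⟩⟩

variable {C : Type u} [Category.{v} C] [HasZeroMorphisms C] [HasFiniteLimits C]

/-- A reflexive relation in a protomodular category is Euclidean: if `x ~ y` and `x ~ z`, then
`y ~ z`. -/
lemma IsProtomodular.exists_euclidean (hC : IsProtomodular C) {T S Y : C} {ζ : S ⟶ T} {p q : T ⟶ Y}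
    {δ : Y ⟶ T} (h : IsSplitExt ζ p δ) [JointlyMono₂ p q] (hδ : δ ≫ q = 𝟙 Y) {W : C}
    (a b : W ⟶ T) (hab : a ≫ p = b ≫ p) : ∃ c : W ⟶ T, c ≫ p = a ≫ q ∧ c ≫ q = b ≫ q := by
  have := h.mono
  have hpq : Mono (prod.lift p q) :=
    ⟨fun x y hxy => JointlyMono₂.right_cancellation (p₁ := p) (p₂ := q) x y
      (by simpa only [Category.assoc, prod.lift_fst] using congrArg (· ≫ prod.fst) hxy)
      (by simpa only [Category.assoc, prod.lift_snd] using congrArg (· ≫ prod.snd) hxy)⟩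
  have hk : (0 : S ⟶ T) ≫ p = ζ ≫ p := by rw [h.zero, zero_comp]
  have hmono : Mono (pullback.lift 0 ζ hk) := mono_of_mono_fac (pullback.lift_snd 0 ζ hk)
  -- triples `x ~ y`, `x ~ z` form a split extension over the pairs `x ~ y`, with section `z = y`
  have h' : IsSplitExt (pullback.lift 0 ζ hk) (pullback.fst p p)
      (pullback.lift (𝟙 T) (𝟙 T) rfl) := by
    refine .of_exists_lift ?_ ?_ ?_
    · rw [pullback.lift_fst]
    · rw [pullback.lift_fst]
    · intro W t ht
      obtain ⟨s, hs⟩ := h.exists_lift (t ≫ pullback.snd p p) (by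
        rw [Category.assoc, ← pullback.condition, reassoc_of% ht, zero_comp])
      exact ⟨s, by apply pullback.hom_ext <;> simp [hs, ht]⟩
  obtain ⟨c, hc⟩ := hC.exists_factor h' (prod.lift (pullback.fst p p ≫ q) (pullback.snd p p ≫ q))
    (prod.lift p q) ζ (q ≫ δ)
    (by apply Limits.prod.hom_ext <;> simp [h.zero])
    (by apply Limits.prod.hom_ext <;> simp [h.section_comp, hδ])
  refine ⟨pullback.lift a b hab ≫ c, ?_, ?_⟩
  · simpa using congrArg (pullback.lift a b hab ≫ · ≫ prod.fst) hc
  · simpa using congrArg (pullback.lift a b hab ≫ · ≫ prod.snd) hc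

/-- A Bourn-normal monomorphism is the zero class of a reflexive relation `p, q`, with reflexivity
`δ`: the zero class is `ζ ≫ q`, where `ζ` is the kernel of `p`. -/
lemma IsBournNormal.exists_zeroClass {S Y : C} {m : S ⟶ Y} (hm : IsBournNormal m) :
    ∃ (T : C) (ζ : S ⟶ T) (p q : T ⟶ Y) (δ : Y ⟶ T), JointlyMono₂ p q ∧ IsSplitExt ζ p δ ∧
      δ ≫ q = 𝟙 Y ∧ ζ ≫ q = m := by
  obtain ⟨hmono, R, r₁, r₂, ⟨⟨e⟩⟩, t, h₁, h₂⟩ := hm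
  have hζ : (prod.lift 0 (𝟙 S) ≫ t) ≫ r₂ = m := by simp [h₂.w]
  have : Mono (prod.lift 0 (𝟙 S) ≫ t) := mono_of_mono_fac hζ
  refine ⟨R, prod.lift 0 (𝟙 S) ≫ t, r₁, r₂, e.r, e.toJointlyMono₂,
    .of_exists_lift e.reflexivity₁ (by simp [h₁.w]) fun W τ hτ => ?_, e.reflexivity₂, hζ⟩
  refine ⟨h₁.lift τ 0 (by simp [hτ]) ≫ prod.snd, ?_⟩
  have : h₁.lift τ 0 (by simp [hτ]) ≫ prod.snd ≫ prod.lift 0 (𝟙 S) =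
      h₁.lift τ 0 (by simp [hτ]) := by
    apply Limits.prod.hom_ext <;> simp
  rw [Category.assoc, reassoc_of% this, h₁.lift_fst]

/-- In a protomodular category, the zero class of a reflexive relation is Bourn-normal to it. -/
lemma IsProtomodular.isBournNormal_of_zeroClass (hC : IsProtomodular C) {T S Y : C} {ζ : S ⟶ T}
    {p q : T ⟶ Y} {δ : Y ⟶ T} (h : IsSplitExt ζ p δ) (hpq : JointlyMono₂ p q)
    (hδ : δ ≫ q = 𝟙 Y) : IsBournNormal (ζ ≫ q) := by
  have hζ := h.mono
  have hm : Mono (ζ ≫ q) := ⟨fun a b hab => (cancel_mono ζ).1 <|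
    JointlyMono₂.right_cancellation (p₁ := p) (p₂ := q) _ _ (by simp [h.zero]) (by simpa using hab)⟩
  -- from `x ~ y` and `x ~ x` follows `y ~ x`
  obtain ⟨s, hs₁, hs₂⟩ := hC.exists_euclidean h hδ (𝟙 T) (p ≫ δ) (by simp [h.section_comp])
  rw [Category.id_comp] at hs₁
  rw [Category.assoc, hδ, Category.comp_id] at hs₂
  have trans : ∀ {W : C} (a b : W ⟶ T), a ≫ q = b ≫ p →
      ∃ c : W ⟶ T, c ≫ p = a ≫ p ∧ c ≫ q = b ≫ q := by
    intro W a b hab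
    obtain ⟨c, hc₁, hc₂⟩ := hC.exists_euclidean h hδ (a ≫ s) b (by simp [hs₁, hab])
    exact ⟨c, by simpa [hs₂] using hc₁, hc₂⟩
  obtain ⟨c, hc₁, hc₂⟩ := trans (pullback.fst q p) (pullback.snd q p) pullback.condition
  have hequiv : EquivalenceRelation p q :=
    { right_cancellation := hpq.right_cancellation
      r := δ
      reflexivity₁ := h.section_comp
      reflexivity₂ := hδ
      s := s
      symmetry₁ := hs₁
      symmetry₂ := hs₂
      c := pullback.cone q p
      isLimit := pullback.isLimit q p
      t := c
      transitivity₁ := hc₁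
      transitivity₂ := hc₂ }
  obtain ⟨t, ht₁, ht₂⟩ := hC.exists_euclidean h hδ (prod.fst ≫ ζ : S ⨯ S ⟶ T) (prod.snd ≫ ζ)
    (by simp [h.zero])
  have ht : Mono t := ⟨fun a b hab => by
    apply Limits.prod.hom_ext
    · rw [← cancel_mono (ζ ≫ q)]
      simpa [ht₁] using congrArg (· ≫ p) hab
    · rw [← cancel_mono (ζ ≫ q)]
      simpa [ht₂] using congrArg (· ≫ q) hab⟩
  -- if `m y ~ b`, then `0 ~ m y ~ b`, so `b` lies in the zero class
  have key : ∀ {W : C} (x : W ⟶ T) (y : W ⟶ S), x ≫ p = y ≫ ζ ≫ q →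
      ∃ z : W ⟶ S, prod.lift y z ≫ t = x := by
    intro W x y hxy
    obtain ⟨d, hd₁, hd₂⟩ := trans (y ≫ ζ) x (by simp [hxy])
    obtain ⟨z, rfl⟩ := h.exists_lift d (by simp [hd₁, h.zero])
    refine ⟨z, JointlyMono₂.right_cancellation (p₁ := p) (p₂ := q) _ _ ?_ ?_⟩
    · simp [ht₁, hxy]
    · simpa [ht₂] using hd₂
  refine ⟨hm, T, p, q, ⟨⟨hequiv⟩⟩, t, isPullback_of_exists_lift (by simpa using ht₁) ?_,
    isPullback_of_exists_lift (by simpa using ht₂) ?_⟩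
  · intro W x y hxy
    obtain ⟨z, hz⟩ := key x y hxy
    exact ⟨prod.lift y z, hz, prod.lift_fst _ _⟩
  · intro W x y hxy
    obtain ⟨z, hz⟩ := key (x ≫ s) y (by simp [hs₁, hxy])
    refine ⟨prod.lift z y, JointlyMono₂.right_cancellation (p₁ := p) (p₂ := q) _ _ ?_ ?_,
      prod.lift_snd _ _⟩
    · simpa [ht₁, ht₂, hs₂] using congrArg (· ≫ q) hz
    · simp [ht₂, hxy]

/-- The kernel in a split extension is the zero class of the kernel pair. -/
lemma IsSplitExt.isBournNormal (hC : IsProtomodular C) {X A B : C} {κ : X ⟶ A} {α : A ⟶ B}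
    {β : B ⟶ A} (h : IsSplitExt κ α β) : IsBournNormal κ := by
  have := h.mono
  have hw : (0 : X ⟶ A) ≫ α = κ ≫ α := by simp [h.zero]
  have hmono : Mono (pullback.lift 0 κ hw) := mono_of_mono_fac (pullback.lift_snd 0 κ hw)
  have h' : IsSplitExt (pullback.lift 0 κ hw) (pullback.fst α α)
      (pullback.lift (𝟙 A) (𝟙 A) rfl) := by
    refine .of_exists_lift (by simp) (by simp) fun W t ht => ?_
    obtain ⟨s, hs⟩ := h.exists_lift (t ≫ pullback.snd α α) (by
      rw [Category.assoc, ← pullback.condition, reassoc_of% ht, zero_comp])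
    exact ⟨s, by apply pullback.hom_ext <;> simp [hs, ht]⟩
  have := hC.isBournNormal_of_zeroClass h' (q := pullback.snd α α)
    ⟨fun _ _ _ h₁ h₂ => pullback.hom_ext h₁ h₂⟩ (by simp)
  simpa using this

/-- A morphism `u` into `X` is characteristic when its composite with the kernel of the generic split
extension is Bourn-normal. -/
lemma isCharacteristic_of_isBournNormal (hC : IsProtomodular C) {S X : C} {G : SplitExt X}
    (hG : IsGeneric G) {u : S ⟶ X} (hu : IsBournNormal (u ≫ G.κ)) : IsCharacteristic u := by
  intro Y n hn
  obtain ⟨R, ζ, r₁, r₂, δ, hR, hR', hδ, rfl⟩ := hn.exists_zeroClass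
  obtain ⟨Q, η, q₁, q₂, ε, hQ, hQ', hε, hη⟩ := hu.exists_zeroClass
  let φ := hG.from ⟨R, Y, ζ, r₁, δ, hR'⟩
  obtain ⟨v, hv⟩ : ∃ v : R ⟶ G.A, ζ ≫ v = G.κ := ⟨φ.v, φ.κ_comm.trans (Category.id_comp _)⟩
  have := hR'.mono
  have := hQ'.mono
  have := G.isSplitExt.mono
  -- the pullback of `g` along `f` is the relation `{(y, y') ∈ R | (v (y, y), v (y, y')) ∈ Q}`
  let f : R ⟶ G.A ⨯ G.A := prod.lift (r₁ ≫ δ ≫ v) v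
  let g : Q ⟶ G.A ⨯ G.A := prod.lift q₁ q₂
  have hζ : η ≫ g = (u ≫ ζ) ≫ f := by
    apply Limits.prod.hom_ext
    · simp [f, g, hQ'.zero, reassoc_of% hR'.zero]
    · simp [f, g, hη, hv]
  have hr : (δ ≫ v ≫ ε) ≫ g = δ ≫ f := by
    apply Limits.prod.hom_ext
    · simp [f, g, hQ'.section_comp, reassoc_of% hR'.section_comp]
    · simp [f, g, hε]
  have hmono : Mono (pullback.lift η (u ≫ ζ) hζ) := mono_of_mono_fac (pullback.lift_fst _ _ hζ)
  have hfst : pullback.fst g f ≫ q₁ = pullback.snd g f ≫ r₁ ≫ δ ≫ v := by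
    simpa [f, g] using congrArg (· ≫ prod.fst) (pullback.condition (f := g) (g := f))
  have hsnd : pullback.fst g f ≫ q₂ = pullback.snd g f ≫ v := by
    simpa [f, g] using congrArg (· ≫ prod.snd) (pullback.condition (f := g) (g := f))
  have h' : IsSplitExt (pullback.lift η (u ≫ ζ) hζ) (pullback.snd g f ≫ r₁)
      (pullback.lift (δ ≫ v ≫ ε) δ hr) := by
    refine .of_exists_lift (by simp [hR'.section_comp]) (by simp [hR'.zero]) fun W t ht => ?_
    rw [← Category.assoc] at ht
    obtain ⟨x, hx⟩ := hR'.exists_lift _ ht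
    obtain ⟨s, hs⟩ := hQ'.exists_lift (t ≫ pullback.fst g f) (by
      rw [Category.assoc, hfst, ← Category.assoc, ← Category.assoc, ht, zero_comp])
    have hsx : s ≫ u = x := by
      rw [← cancel_mono G.κ, Category.assoc, ← hη, reassoc_of% hs, hsnd, ← reassoc_of% hx, hv]
    exact ⟨s, by apply pullback.hom_ext <;> simp [hs, ← hx, ← hsx]⟩
  have := hC.isBournNormal_of_zeroClass h' (q := pullback.snd g f ≫ r₂)
    ⟨fun W a b h₁ h₂ => by
      have hab : a ≫ pullback.snd g f = b ≫ pullback.snd g f :=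
        JointlyMono₂.right_cancellation (p₁ := r₁) (p₂ := r₂) _ _ (by simpa using h₁)
          (by simpa using h₂)
      refine pullback.hom_ext (JointlyMono₂.right_cancellation (p₁ := q₁) (p₂ := q₂) _ _ ?_ ?_) hab
      · simp only [Category.assoc, hfst, reassoc_of% hab]
      · simp only [Category.assoc, hsnd, reassoc_of% hab]⟩ (by simp [hδ])
  simpa using this

end BournNormal

/-! ### Split extensions in the category of morphisms -/

section ArrowCategory

variable {C : Type u} [Category.{v} C] [HasZeroMorphisms C]

/-- The domain of a split extension in the category of morphisms is a split extension. Elements of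
a domain are tested by morphisms from the identity arrows. -/
lemma IsSplitExt.left {X A B : Arrow C} {κ : X ⟶ A} {α : A ⟶ B} {β : B ⟶ A}
    (h : IsSplitExt κ α β) :
    IsSplitExt (Arrow.Hom.left κ) (Arrow.Hom.left α) (Arrow.Hom.left β) := by
  have hκ := h.mono
  have hmono : Mono (Arrow.Hom.left κ) := by
    refine ⟨fun {W} s s' hs => ?_⟩
    let T : Arrow.mk (𝟙 W) ⟶ X := Arrow.homMk s (s ≫ X.hom) (by simp)
    let T' : Arrow.mk (𝟙 W) ⟶ X := Arrow.homMk s' (s' ≫ X.hom) (by simp)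
    have hT : T = T' := (cancel_mono κ).1 (by
      apply Arrow.hom_ext
      · exact hs
      · change (s ≫ X.hom) ≫ Arrow.Hom.right κ = (s' ≫ X.hom) ≫ Arrow.Hom.right κ
        rw [Category.assoc, Category.assoc, ← Arrow.w κ, reassoc_of% hs])
    exact congrArg Arrow.Hom.left hT
  refine .of_exists_lift (congrArg Arrow.Hom.left h.section_comp) (congrArg Arrow.Hom.left h.zero)
    fun W t ht => ?_
  let T : Arrow.mk (𝟙 W) ⟶ A := Arrow.homMk t (t ≫ A.hom) (by simp)
  obtain ⟨s, hs⟩ := h.exists_lift T (by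
    apply Arrow.hom_ext
    · exact ht
    · change (t ≫ A.hom) ≫ Arrow.Hom.right α = 0
      rw [Category.assoc, ← Arrow.w α, reassoc_of% ht, zero_comp])
  exact ⟨Arrow.Hom.left s, congrArg Arrow.Hom.left hs⟩

/-- A morphism `(u, v, 𝟙)` of split extensions over the same base, from `(κ, α, β)` to `G`, as a
split extension with kernel `(S, X, u)` in the category of morphisms. -/
def SplitExt.ofHom {S X A : C} (G : SplitExt X) {u : S ⟶ X} {κ : S ⟶ A} {α : A ⟶ G.B}
    {β : G.B ⟶ A} (h : IsSplitExt κ α β) (v : A ⟶ G.A) (hκ : κ ≫ v = u ≫ G.κ)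
    (hα : v ≫ G.α = α) (hβ : β ≫ v = G.β) : SplitExt (Arrow.mk u) where
  A := Arrow.mk v
  B := Arrow.mk (𝟙 G.B)
  κ := Arrow.homMk κ G.κ hκ
  α := Arrow.homMk α G.α (by simpa using hα.symm)
  β := Arrow.homMk β G.β (by simpa using hβ)
  isSplitExt := by
    have := h.mono
    have := G.isSplitExt.mono
    have hmono : Mono (Arrow.homMk (f := Arrow.mk u) (g := Arrow.mk v) κ G.κ hκ) :=
      ⟨fun a b hab => by
        apply Arrow.hom_ext
        · exact (cancel_mono κ).1 (congrArg Arrow.Hom.left hab)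
        · exact (cancel_mono G.κ).1 (congrArg Arrow.Hom.right hab)⟩
    refine .of_exists_lift ?_ ?_ ?_
    · apply Arrow.hom_ext
      · exact h.section_comp
      · exact G.isSplitExt.section_comp
    · apply Arrow.hom_ext
      · exact h.zero
      · exact G.isSplitExt.zero
    · intro W t ht
      obtain ⟨s, hs⟩ := h.exists_lift (Arrow.Hom.left t) (congrArg Arrow.Hom.left ht)
      obtain ⟨s', hs'⟩ := G.isSplitExt.exists_lift (Arrow.Hom.right t)
        (congrArg Arrow.Hom.right ht)
      refine ⟨Arrow.homMk s s' ?_, ?_⟩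
      · change s ≫ u = W.hom ≫ s'
        rw [← cancel_mono G.κ, Category.assoc, Category.assoc, ← hκ, hs', reassoc_of% hs]
        exact Arrow.w t
      · apply Arrow.hom_ext
        · exact hs
        · exact hs'

variable [HasZeroObject C]

/-- The counterpart of `q₂` on the middle objects: the domain of a split extension `E` with kernel
`(S, X, u)` in the category of morphisms is sent to the generic split extension with kernel `X`. -/
def domHom {S X : C} {u : S ⟶ X} {G : SplitExt X} (hG : IsGeneric G) (E : SplitExt (Arrow.mk u)) :
    E.A.left ⟶ G.A :=
  E.A.hom ≫ (hG.from E.cod).v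

/-- The triple `(u, domHom hG E, q₂ hG E)` is a morphism of split extensions. -/
lemma domHom_comm {S X : C} {u : S ⟶ X} {G : SplitExt X} (hG : IsGeneric G)
    (E : SplitExt (Arrow.mk u)) :
    Arrow.Hom.left E.κ ≫ domHom hG E = u ≫ G.κ ∧
      Arrow.Hom.left E.β ≫ domHom hG E = q₂ hG E ≫ G.β ∧
      domHom hG E ≫ G.α = Arrow.Hom.left E.α ≫ q₂ hG E := by
  obtain ⟨v, w, hv, hw, vκ, vβ, vα⟩ : ∃ (v : E.A.right ⟶ G.A) (w : E.B.right ⟶ G.B),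
      domHom hG E = E.A.hom ≫ v ∧ q₂ hG E = E.B.hom ≫ w ∧ Arrow.Hom.right E.κ ≫ v = G.κ ∧
      Arrow.Hom.right E.β ≫ v = w ≫ G.β ∧ v ≫ G.α = Arrow.Hom.right E.α ≫ w :=
    ⟨(hG.from E.cod).v, (hG.from E.cod).w, rfl, rfl,
      (hG.from E.cod).κ_comm.trans (Category.id_comp _), (hG.from E.cod).β_comm,
      (hG.from E.cod).α_comm⟩
  have wκ : Arrow.Hom.left E.κ ≫ E.A.hom = u ≫ Arrow.Hom.right E.κ := Arrow.w E.κ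
  have wβ : Arrow.Hom.left E.β ≫ E.A.hom = E.B.hom ≫ Arrow.Hom.right E.β := Arrow.w E.β
  have wα : Arrow.Hom.left E.α ≫ E.B.hom = E.A.hom ≫ Arrow.Hom.right E.α := Arrow.w E.α
  rw [hv, hw]
  refine ⟨?_, ?_, ?_⟩
  · rw [reassoc_of% wκ]
    exact congrArg (u ≫ ·) vκ
  · rw [reassoc_of% wβ, vβ, Category.assoc]
  · rw [Category.assoc, vα, reassoc_of% wα]

/-- For `v` a monomorphism, the morphism `domHom hG F` factors through `v`, since its restrictions to
the kernel and to the section do; this gives the domain part of the morphism from `F`. -/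
lemma SplitExt.nonempty_isGeneric_ofHom [HasFiniteLimits C] (hC : IsProtomodular C) {S X A : C}
    {G : SplitExt X} (hG : IsGeneric G) {u : S ⟶ X} {κ : S ⟶ A} {α : A ⟶ G.B}
    {β : G.B ⟶ A} (h : IsSplitExt κ α β) (v : A ⟶ G.A) [Mono v] (hκ : κ ≫ v = u ≫ G.κ)
    (hα : v ≫ G.α = α) (hβ : β ≫ v = G.β) : Nonempty (IsGeneric (G.ofHom h v hκ hα hβ)) := by
  have ex : ∀ F : SplitExt (Arrow.mk u), Nonempty (F ⟶ G.ofHom h v hκ hα hβ) := by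
    intro F
    let φ := hG.from F.cod
    obtain ⟨dκ, dβ, dα⟩ := domHom_comm hG F
    obtain ⟨g, hg⟩ := hC.exists_factor F.isSplitExt.left (domHom hG F) v κ (q₂ hG F ≫ β)
      (hκ.trans dκ.symm) (by rw [dβ, Category.assoc, hβ])
    refine ⟨⟨Arrow.homMk (u := g) (v := φ.v) hg,
      Arrow.homMk (u := q₂ hG F) (v := φ.w) (Category.comp_id _), ?_, ?_, ?_⟩⟩
    · apply Arrow.hom_ext
      · change Arrow.Hom.left F.κ ≫ g = 𝟙 S ≫ κ
        rw [← cancel_mono v, Category.assoc, hg, Category.id_comp, hκ]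
        exact dκ
      · exact φ.κ_comm
    · apply Arrow.hom_ext
      · change Arrow.Hom.left F.β ≫ g = q₂ hG F ≫ β
        rw [← cancel_mono v, Category.assoc, hg, dβ, Category.assoc, hβ]
      · exact φ.β_comm
    · apply Arrow.hom_ext
      · change g ≫ α = Arrow.Hom.left F.α ≫ q₂ hG F
        rw [← hα, reassoc_of% hg, dα]
      · exact φ.α_comm
  have uniq : ∀ {F : SplitExt (Arrow.mk u)} (a b : F ⟶ G.ofHom h v hκ hα hβ), a = b := by
    intro F a b
    let cod (c : F ⟶ G.ofHom h v hκ hα hβ) : F.cod ⟶ G :=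
      ⟨Arrow.Hom.right c.v, Arrow.Hom.right c.w, congrArg Arrow.Hom.right c.κ_comm,
        congrArg Arrow.Hom.right c.β_comm, congrArg Arrow.Hom.right c.α_comm⟩
    have hab : cod a = cod b := hG.hom_ext _ _
    have hv : Arrow.Hom.right a.v = Arrow.Hom.right b.v := congrArg HomOver.v hab
    have hw : Arrow.Hom.right a.w = Arrow.Hom.right b.w := congrArg HomOver.w hab
    have av : Arrow.Hom.left a.v ≫ v = F.A.hom ≫ Arrow.Hom.right a.v := Arrow.w a.v
    have bv : Arrow.Hom.left b.v ≫ v = F.A.hom ≫ Arrow.Hom.right b.v := Arrow.w b.v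
    have aw : Arrow.Hom.left a.w ≫ 𝟙 G.B = F.B.hom ≫ Arrow.Hom.right a.w := Arrow.w a.w
    have bw : Arrow.Hom.left b.w ≫ 𝟙 G.B = F.B.hom ≫ Arrow.Hom.right b.w := Arrow.w b.w
    refine HomOver.ext (Arrow.hom_ext _ _ ?_ hv) (Arrow.hom_ext _ _ ?_ hw)
    · exact (cancel_mono v).1 (av.trans ((congrArg (F.A.hom ≫ ·) hv).trans bv.symm))
    · exact (cancel_mono (𝟙 G.B)).1 (aw.trans ((congrArg (F.B.hom ≫ ·) hw).trans bw.symm))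
  exact ⟨IsTerminal.ofUniqueHom (fun F => (ex F).some) fun F m => uniq _ _⟩

lemma isIso_q₂_ofHom {S X A : C} {G : SplitExt X} (hG : IsGeneric G) {u : S ⟶ X} {κ : S ⟶ A}
    {α : A ⟶ G.B} {β : G.B ⟶ A} (h : IsSplitExt κ α β) (v : A ⟶ G.A) (hκ : κ ≫ v = u ≫ G.κ)
    (hα : v ≫ G.α = α) (hβ : β ≫ v = G.β) : IsIso (q₂ hG (G.ofHom h v hκ hα hβ)) := by
  have hid : hG.from (G.ofHom h v hκ hα hβ).cod = 𝟙 G := hG.hom_ext (X := G) _ _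
  have hq : q₂ hG (G.ofHom h v hκ hα hβ) = 𝟙 G.B := by
    change 𝟙 G.B ≫ (hG.from (G.ofHom h v hκ hα hβ).cod).w = 𝟙 G.B
    rw [hid]
    exact Category.comp_id _
  rw [hq]
  exact inferInstanceAs (IsIso (𝟙 G.B))

lemma isIso_q₂_of_isGeneric {S X : C} {u : S ⟶ X} {G : SplitExt X} (hG : IsGeneric G)
    {E E' : SplitExt (Arrow.mk u)} (hE : IsGeneric E) (hE' : IsGeneric E')
    [IsIso (q₂ hG E')] : IsIso (q₂ hG E) := by
  let e : E ⟶ E' := hE'.from E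
  let e' : E' ⟶ E := hE.from E'
  have h₁ : e ≫ e' = 𝟙 E := hE.hom_ext _ _
  have h₂ : e' ≫ e = 𝟙 E' := hE'.hom_ext _ _
  have hl : IsIso (Arrow.Hom.left e.w) :=
    ⟨Arrow.Hom.left e'.w, congrArg (fun f : E ⟶ E => Arrow.Hom.left f.w) h₁,
      congrArg (fun f : E' ⟶ E' => Arrow.Hom.left f.w) h₂⟩
  let c : E.cod ⟶ E'.cod := ⟨Arrow.Hom.right e.v, Arrow.Hom.right e.w,
    congrArg Arrow.Hom.right e.κ_comm, congrArg Arrow.Hom.right e.β_comm,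
    congrArg Arrow.Hom.right e.α_comm⟩
  have hc : hG.from E.cod = c ≫ hG.from E'.cod := hG.hom_ext _ _
  have hcw : (hG.from E.cod).w = Arrow.Hom.right e.w ≫ (hG.from E'.cod).w :=
    congrArg SplitExt.HomOver.w hc
  have hw : Arrow.Hom.left e.w ≫ E'.B.hom = E.B.hom ≫ Arrow.Hom.right e.w := Arrow.w e.w
  have hq : q₂ hG E = Arrow.Hom.left e.w ≫ q₂ hG E' :=
    (congrArg (E.B.hom ≫ ·) hcw).trans <| (Category.assoc _ _ _).symm.trans <|
      (congrArg (· ≫ (hG.from E'.cod).w) hw.symm).trans (Category.assoc _ _ _)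
  rw [hq]
  infer_instance

/-- If `u ≫ G.κ` is the zero class of a reflexive relation `Q`, the elements of `G.A` related by `Q` to
their projection on the section form the domain of a generic split extension with kernel
`(S, X, u)`. -/
lemma exists_isGeneric_of_isBournNormal [HasFiniteLimits C] (hC : IsProtomodular C) {S X : C}
    {G : SplitExt X} (hG : IsGeneric G) {u : S ⟶ X} (hu : IsBournNormal (u ≫ G.κ)) :
    ∃ E : SplitExt (Arrow.mk u), Nonempty (IsGeneric E) ∧ IsIso (q₂ hG E) := by
  obtain ⟨Q, η, q₁, q₂, ε, hQ, hQ', hε, hη⟩ := hu.exists_zeroClass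
  have := hQ'.mono
  have := G.isSplitExt.mono
  -- the pullback of `g` along `f` is the subobject of those `a` for which `(β (α a), a)` is in `Q`
  let f : G.A ⟶ G.A ⨯ G.A := prod.lift (G.α ≫ G.β) (𝟙 G.A)
  let g : Q ⟶ G.A ⨯ G.A := prod.lift q₁ q₂
  have hg : Mono g := ⟨fun a b hab => JointlyMono₂.right_cancellation (p₁ := q₁) (p₂ := q₂) a b
    (by simpa only [g, Category.assoc, prod.lift_fst] using congrArg (· ≫ prod.fst) hab)
    (by simpa only [g, Category.assoc, prod.lift_snd] using congrArg (· ≫ prod.snd) hab)⟩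
  have hκ : η ≫ g = (u ≫ G.κ) ≫ f := by
    apply Limits.prod.hom_ext
    · simp [f, g, hQ'.zero, reassoc_of% G.isSplitExt.zero]
    · simp [f, g, hη]
  have hβ : (G.β ≫ ε) ≫ g = G.β ≫ f := by
    apply Limits.prod.hom_ext
    · simp [f, g, hQ'.section_comp, reassoc_of% G.isSplitExt.section_comp]
    · simp [f, g, hε]
  have hfst : pullback.fst g f ≫ q₁ = pullback.snd g f ≫ G.α ≫ G.β := by
    simpa only [g, f, Category.assoc, prod.lift_fst] using
      congrArg (· ≫ prod.fst) (pullback.condition (f := g) (g := f))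
  have hsnd : pullback.fst g f ≫ q₂ = pullback.snd g f := by
    simpa only [g, f, Category.assoc, prod.lift_snd, Category.comp_id] using
      congrArg (· ≫ prod.snd) (pullback.condition (f := g) (g := f))
  have hmono : Mono (pullback.lift η (u ≫ G.κ) hκ) := mono_of_mono_fac (pullback.lift_fst _ _ hκ)
  have h' : IsSplitExt (pullback.lift η (u ≫ G.κ) hκ) (pullback.snd g f ≫ G.α)
      (pullback.lift (G.β ≫ ε) G.β hβ) := by
    refine .of_exists_lift (by simp [G.isSplitExt.section_comp]) (by simp [G.isSplitExt.zero])
      fun W t ht => ?_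
    obtain ⟨s, hs⟩ := hQ'.exists_lift (t ≫ pullback.fst g f) (by
      rw [← Category.assoc] at ht
      rw [Category.assoc, hfst, ← Category.assoc, ← Category.assoc, ht, zero_comp])
    refine ⟨s, pullback.hom_ext (by simp [hs]) ?_⟩
    rw [Category.assoc, pullback.lift_snd, ← hη, reassoc_of% hs, hsnd]
  exact ⟨_, G.nonempty_isGeneric_ofHom hC hG h' (pullback.snd g f) (pullback.lift_snd _ _ hκ) rfl
    (pullback.lift_snd _ _ hβ), isIso_q₂_ofHom hG h' _ _ _ _⟩

/-- Along `X ⨯ X ⟶ G.A`, which classifies the conjugation action of `X` on itself, the domain of `E`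
pulls back to a reflexive relation with zero class `u`. Hence `u` is Bourn-normal, and strong
protomodularity carries this over to `u ≫ G.κ`. -/
lemma IsStronglyProtomodular.isBournNormal_comp [HasFiniteLimits C]
    (hC : IsStronglyProtomodular C) {S X : C} {G : SplitExt X} (hG : IsGeneric G) {u : S ⟶ X}
    [Mono u] (E : SplitExt (Arrow.mk u)) [IsIso (q₂ hG E)] : IsBournNormal (u ≫ G.κ) := by
  -- the domain of `E`, with its base replaced by `G.B` along the isomorphism `q₂ hG E`
  obtain ⟨D, κ, α, β, v, h, hκ, hβ, hα⟩ : ∃ (D : C) (κ : S ⟶ D) (α : D ⟶ G.B) (β : G.B ⟶ D)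
      (v : D ⟶ G.A), IsSplitExt κ α β ∧ κ ≫ v = u ≫ G.κ ∧ β ≫ v = G.β ∧ v ≫ G.α = α := by
    obtain ⟨dκ, dβ, dα⟩ := domHom_comm hG E
    have hl := E.isSplitExt.left
    have := hl.mono
    refine ⟨E.A.left, Arrow.Hom.left E.κ, Arrow.Hom.left E.α ≫ q₂ hG E,
      inv (q₂ hG E) ≫ Arrow.Hom.left E.β, domHom hG E, .of_exists_lift ?_ ?_ ?_, dκ, ?_, dα⟩
    · rw [Category.assoc, reassoc_of% hl.section_comp, IsIso.inv_hom_id]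
    · rw [reassoc_of% hl.zero, zero_comp]
    · intro W t ht
      exact hl.exists_lift t (by rw [← cancel_mono (q₂ hG E), Category.assoc, ht, zero_comp])
    · rw [Category.assoc, dβ, IsIso.inv_hom_id_assoc]
  refine (hC.2 κ α β G.κ G.α G.β u v h G.isSplitExt hκ hβ hα).1 ?_
  have := h.mono
  have := G.isSplitExt.mono
  have := hC.1.mono_of_mono_kernel h G.κ G.α u v hκ hα
  have hX : IsSplitExt (prod.lift 0 (𝟙 X)) (prod.fst : X ⨯ X ⟶ X) (prod.lift (𝟙 X) (𝟙 X)) := by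
    have : Mono (prod.lift (0 : X ⟶ X) (𝟙 X)) := mono_of_mono_fac (prod.lift_snd _ _)
    exact .of_exists_lift (by simp) (by simp) fun W t ht =>
      ⟨t ≫ prod.snd, by apply Limits.prod.hom_ext <;> simp [ht]⟩
  let c := hG.from ⟨_, _, _, _, _, hX⟩
  have cκ : prod.lift 0 (𝟙 X) ≫ c.v = G.κ := c.κ_comm.trans (Category.id_comp _)
  have cβ : prod.lift (𝟙 X) (𝟙 X) ≫ c.v = c.w ≫ G.β := c.β_comm
  have cα : c.v ≫ G.α = prod.fst ≫ c.w := c.α_comm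
  have hζ : κ ≫ v = (u ≫ prod.lift 0 (𝟙 X)) ≫ c.v := by rw [hκ, Category.assoc, cκ]
  have hδ : (c.w ≫ β) ≫ v = prod.lift (𝟙 X) (𝟙 X) ≫ c.v := by rw [cβ, Category.assoc, hβ]
  have hmono : Mono (pullback.lift κ (u ≫ prod.lift 0 (𝟙 X)) hζ) :=
    mono_of_mono_fac (pullback.lift_fst _ _ hζ)
  have h' : IsSplitExt (pullback.lift κ (u ≫ prod.lift 0 (𝟙 X)) hζ)
      (pullback.snd v c.v ≫ prod.fst) (pullback.lift (c.w ≫ β) (prod.lift (𝟙 X) (𝟙 X)) hδ) := by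
    refine .of_exists_lift (by simp) (by simp) fun W t ht => ?_
    obtain ⟨s, hs⟩ := h.exists_lift (t ≫ pullback.fst v c.v) (by
      rw [← Category.assoc] at ht
      rw [← hα, Category.assoc, pullback.condition_assoc, cα, ← Category.assoc, ← Category.assoc,
        ht, zero_comp])
    obtain ⟨x, hx⟩ := hX.exists_lift (t ≫ pullback.snd v c.v) (by rw [Category.assoc, ht])
    have hsx : s ≫ u = x := by
      rw [← cancel_mono G.κ, Category.assoc, ← hκ, reassoc_of% hs, pullback.condition,
        ← reassoc_of% hx, cκ]
    exact ⟨s, pullback.hom_ext (by simp [hs]) (by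
      rw [Category.assoc, pullback.lift_snd, reassoc_of% hsx, hx])⟩
  have := hC.1.isBournNormal_of_zeroClass h' (q := pullback.snd v c.v ≫ prod.snd)
    ⟨fun W a b h₁ h₂ => by
      rw [← cancel_mono (pullback.snd v c.v)]
      exact Limits.prod.hom_ext (by simpa using h₁) (by simpa using h₂)⟩ (by simp)
  simpa using this

end ArrowCategory

end SplitExtensions

open SplitExtensions in
theorem mainTheorem5 {C : Type u} [Category.{v} C] [HasZeroObject C] [HasZeroMorphisms C]
    [HasFiniteLimits C] (hC : IsProtomodular C) {X : C} (G : SplitExt X) (hG : IsGeneric G)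
    {S : C} (u : S ⟶ X) :
    (IsCharacteristic u ↔ IsBournNormal (u ≫ G.κ)) ∧
    (IsCharacteristic u →
      (∃ E : SplitExt (Arrow.mk u), Nonempty (IsGeneric E)) ∧
      ∀ E : SplitExt (Arrow.mk u), IsGeneric E → IsIso (q₂ hG E)) ∧
    (IsStronglyProtomodular C → Mono u →
      (∃ E : SplitExt (Arrow.mk u), Nonempty (IsGeneric E) ∧ IsIso (q₂ hG E)) →
      IsCharacteristic u) := by
  have hk : IsBournNormal G.κ := G.isSplitExt.isBournNormal hC
  refine ⟨⟨fun hu => hu G.κ hk, isCharacteristic_of_isBournNormal hC hG⟩, fun hu => ?_,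
    fun hC' _ ⟨E, _, _⟩ => isCharacteristic_of_isBournNormal hC hG (hC'.isBournNormal_comp hG E)⟩
  obtain ⟨E, ⟨hE⟩, hq⟩ := exists_isGeneric_of_isBournNormal hC hG (hu G.κ hk)
  exact ⟨⟨E, ⟨hE⟩⟩, fun F hF => isIso_q₂_of_isGeneric hG hF hE⟩
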